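/- Let $k$ be an algebraically closed field, let $t \ge 1$, and let $R_1, \dots, R_t$ be complete Noetherian local normal domains of Krull dimension two which are $k$-algebras. For each $1 \le i \le t$ let $$\pi_i : R_i \longrightarrow \bar R_i := k[[\bar u_i, \bar v_i]]/(\bar u_i \bar v_i)$$ be a surjective ring homomorphism. Let $\tilde\pi_i^{(1)}, \tilde\pi_i^{(2)} : R_i \to k[[T]]$ be the two components of the composition of $\pi_i$ with the normalization map $k[[\bar u_i,\bar v_i]]/(\bar u_i\bar v_i) \to k[[T]] \times k[[T]]$, $f(\bar u_i,\bar v_i) \mapsto (f(T,0), f(0,T))$. Put $R := R_1 \times \dots \times R_t$, read all indices cyclically (so that $t+1$ means $1$), and set $$A := \{ (r_1,\dots,r_t) \in R \mid \tilde\pi_i^{(2)}(r_i) = \tilde\pi_{i+1}^{(1)}(r_{i+1}) \text{ for all } 1 \le i \le t\},$$ $$I := \{ (r_1,\dots,r_t) \in R \mid \pi_i(r_i) = 0 \text{ for all } 1 \le i \le t\}.$$ Then: 1. The ring $A$ is local and reduced, and the ring extension $A \subseteq R$ is finite. 2. $I$ is the conductor ideal $\{c \in R \mid cR \subseteq A\}$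 of $A \subseteq R$, and multiplication $c \mapsto (r \mapsto cr)$ is an isomorphism $I \cong \operatorname{Hom}_A(R, A)$ of $A$-modules. 3. The ring $A$ is Noetherian and complete (with respect to its maximal ideal), and $R$ is its normalization, that is, the integral closure of $A$ in its total ring of fractions. In particular, $A$ has Krull dimension two. 4. The homomorphisms $\pi_i$ induce an isomorphism $R/I \cong \prod_{i=1}^t k[[\bar u_i,\bar v_i]]/(\bar u_i \bar v_i)$, and there is a ring isomorphism $$A/I \cong k[[\bar w_1,\dots,\bar w_t]]/(\bar w_i\bar w_j \mid 1 \le i < j \le t)$$ such that, under these identifications, the canonical map $A/I \to R/I$ sends every constant $c \in k$ to $(c, \dots, c)$ and sends $\bar w_i$ to $\bar v_i + \bar u_{i+1}$ for all $1 \le i \le t$, where $\bar u_{t+1} = \bar u_1$. 5. The ring $A$ is Cohen–Macaulay, that is, $\operatorname{Ext}^i_A(A/\mathfrak m, A) = 0$ for all $i < \dim A$, where $\mathfrak m$ is the maximal ideal of $A$. -/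

import Mathlib

noncomputable section

namespace CyclicGluing

universe u

/-- The complete node `k⟦u, v⟧ / (u v)`, where `u = X 0` and `v = X 1`. -/
abbrev Node (k : Type*) [Field k] : Type _ :=
  MvPowerSeries (Fin 2) k ⧸
    Ideal.span {(MvPowerSeries.X 0 * MvPowerSeries.X 1 : MvPowerSeries (Fin 2) k)}

/-- The class of the variable `u` in the node. -/
def nodeU (k : Type*) [Field k] : Node k := Ideal.Quotient.mk _ (MvPowerSeries.X 0)

/-- The class of the variable `v` in the node. -/
def nodeV (k : Type*) [Field k] : Node k := Ideal.Quotient.mk _ (MvPowerSeries.X 1)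

/-- The class of a constant `c` in the node. -/
def nodeC (k : Type*) [Field k] (c : k) : Node k := Ideal.Quotient.mk _ (MvPowerSeries.C c)

/-- The inclusion of a single variable, as the `i`-th of the two variables. -/
def varEmb (i : Fin 2) : Unit ↪ Fin 2 := ⟨fun _ => i, fun _ _ _ => rfl⟩

/-- Setting the variable other than the `i`-th one equal to zero. -/
def setOtherZero (k : Type*) [Field k] (i : Fin 2) :
    MvPowerSeries (Fin 2) k →ₐ[k] PowerSeries k :=
  MvPowerSeries.killCompl (varEmb i)

lemma setOtherZero_X_of_ne (k : Type*) [Field k] {i j : Fin 2} (h : j ≠ i) :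
    setOtherZero k i (MvPowerSeries.X j) = 0 := by
  apply MvPowerSeries.killCompl_monomial_eq_zero
  rintro ⟨x, hx⟩
  have h1 := DFunLike.congr_fun hx j
  rw [Finsupp.single_eq_same, Finsupp.embDomain_of_notMem_range] at h1
  · exact zero_ne_one h1
  · rintro ⟨_, hy⟩
    exact h hy.symm

lemma setOtherZero_eq_zero (k : Type*) [Field k] (i : Fin 2) :
    ∀ f ∈ Ideal.span {(MvPowerSeries.X 0 * MvPowerSeries.X 1 : MvPowerSeries (Fin 2) k)},
      (setOtherZero k i).toRingHom f = 0 := by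
  intro f hf
  obtain ⟨g, rfl⟩ := Ideal.mem_span_singleton'.mp hf
  change setOtherZero k i _ = 0
  rw [map_mul, map_mul]
  rcases eq_or_ne (0 : Fin 2) i with rfl | h
  · rw [setOtherZero_X_of_ne k (i := 0) (j := 1) (by decide), mul_zero, mul_zero]
  · rw [setOtherZero_X_of_ne k h, zero_mul, mul_zero]

/-- The two components of the normalization map `k⟦u, v⟧ / (u v) → k⟦u⟧ × k⟦v⟧`:
`branch k 0` is `f(u, v) ↦ f(T, 0)` and `branch k 1` is `f(u, v) ↦ f(0, T)`. -/
def branch (k : Type*) [Field k] (i : Fin 2) : Node k →+* PowerSeries k :=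
  Ideal.Quotient.lift _ (setOtherZero k i).toRingHom (setOtherZero_eq_zero k i)

/-- The subring `A` of `∏ i, R i` of all tuples such that for every `i` the restriction of
`r i` to the `v`-branch agrees with the restriction of `r (i + 1)` to the `u`-branch.
The index `i + 1` is taken cyclically in `Fin t`. -/
def gluedRing {k : Type*} [Field k] {t : ℕ} [NeZero t] {R : Fin t → Type*}
    [∀ i, CommRing (R i)] (π : ∀ i, R i →+* Node k) : Subring (∀ i, R i) where
  carrier := {r | ∀ i, branch k 1 (π i (r i)) = branch k 0 (π (i + 1) (r (i + 1)))}
  mul_mem' ha hb i := by simp only [Pi.mul_apply, map_mul, ha i, hb i]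
  one_mem' i := by simp only [Pi.one_apply, map_one]
  add_mem' ha hb i := by simp only [Pi.add_apply, map_add, ha i, hb i]
  zero_mem' i := by simp only [Pi.zero_apply, map_zero]
  neg_mem' ha i := by simp only [Pi.neg_apply, map_neg, ha i]

/-- The ideal `I` of `∏ i, R i` of all tuples with `π i (r i) = 0` for all `i`. -/
def kerIdeal {k : Type*} [Field k] {t : ℕ} {R : Fin t → Type*}
    [∀ i, CommRing (R i)] (π : ∀ i, R i →+* Node k) : Ideal (∀ i, R i) :=
  Ideal.pi fun i => RingHom.ker (π i)

/-- The ring `k⟦w_1, …, w_t⟧ / (w_i w_j | i < j)` of `t` coordinate axes. -/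
abbrev AxesRing (k : Type*) [Field k] (t : ℕ) : Type _ :=
  MvPowerSeries (Fin t) k ⧸
    Ideal.span {f : MvPowerSeries (Fin t) k |
      ∃ i j : Fin t, i < j ∧ f = MvPowerSeries.X i * MvPowerSeries.X j}

/-- The class of the variable `w_i` in the ring of coordinate axes. -/
def axesW (k : Type*) [Field k] {t : ℕ} (i : Fin t) : AxesRing k t :=
  Ideal.Quotient.mk _ (MvPowerSeries.X i)

/-- The class of a constant `c` in the ring of coordinate axes. -/
def axesC (k : Type*) [Field k] (t : ℕ) (c : k) : AxesRing k t :=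
  Ideal.Quotient.mk _ (MvPowerSeries.C c)

/-- Over a Noetherian local ring `A` with residue field `κ`, a module `M` is (maximal)
Cohen–Macaulay if it is finitely generated and `Ext^i_A(κ, M) = 0` for all `i < dim A`. -/
def IsCohenMacaulayModule (A : Type u) [CommRing A] [IsLocalRing A] [IsNoetherianRing A]
    (M : Type u) [AddCommGroup M] [Module A M] : Prop :=
  Module.Finite A M ∧
    ∀ i : ℕ, ((i : ℕ∞) : WithBot ℕ∞) < ringKrullDim A →
      Subsingleton (CategoryTheory.Abelian.Ext
        (ModuleCat.of A (IsLocalRing.ResidueField A)) (ModuleCat.of A M) i)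

/-- A Noetherian local ring is Cohen–Macaulay if it is so as a module over itself. -/
def IsCohenMacaulayRing (A : Type*) [CommRing A] [IsLocalRing A] [IsNoetherianRing A] : Prop :=
  IsCohenMacaulayModule A A

end CyclicGluing

end

/-!
Write `R` for the product of the rings `R i`, `A` for the glued ring and `I` for the kernel of the
map of `R` to the product of the nodes. Everything follows from a description of the node: a power
series in several variables lies in the ideal generated by the products of two distinct variables
if and only if it restricts to zero on all coordinate axes, and any power series on the axes with a
common constant term arise by restriction (`mem_span_X_mul_X_iff`, `exists_axisRestrict_eq`).
Hence an element of `R` is determined modulo `I` by its `2 t` branches in `k⟦T⟧`, which can be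
prescribed freely subject to equal constant terms on each node, and `A` is cut out by equalities
between branches. In particular `I` is contained in `A`, and for every `p` in `k⟦T⟧` there is an
element of `A` all of whose branches are `p`. This gives the descriptions of `R / I`, of `A / I` and
of the conductor, and an element of `A` is a unit as soon as its constant term is nonzero.

* Finiteness. Each branch `A → k⟦T⟧` is surjective, so `R / I`, which embeds into the product of
  the branches, is a Noetherian `A`-module. As `I` lies in `A`, this makes `R` itself a Noetherian
  `A`-module (`isNoetherian_of_ideal_le_range`), and `A`, a submodule of `R`, a Noetherian ring.
* Completeness. If `τ` in `A` restricts to `T` on all branches, a product of two elements of the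
  radical of `R` is a multiple of `τ` modulo `I`. So the maximal ideal of `A` induces on `R` the
  topology in which `R` is complete, and `A` is closed with the subspace topology, by the theorem of
  Krull and the Artin–Rees lemma (`isPrecomplete_of_injective`).
* Normalization. The node is not a domain, so `I` contains some `s` with all components nonzero. The
  map `r ↦ (s r) / s` embeds `R` into the total ring of fractions of `A`, where `R` is integrally closed since the `R i`
  are normal. Multiplication by `s` also shows that an `A`-linear map `R → A` is multiplication by
  its value at `1`, which then lies in the conductor `I`.
* Dimension. `A` maps to each `R i` by an integral homomorphism, and every prime of `A` contains the
  kernel of one of these.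
* Depth. If `s ∈ A` is regular and the maximal ideal of `A` multiplies `z` into `s A`, then the
  square of the maximal ideal of `R i` multiplies the component of `z / s` into `R i`, so that
  component lies in `R i` by normality and `dim R i > 1`
  (`mem_range_of_forall_maximalIdeal_mul_mem`). Since `τ` multiplies `z / s` into `A` and `T` is
  regular on the branches, `z / s` satisfies the gluing conditions
  (`dvd_of_forall_dvd_maximalIdeal_mul`). So the residue field has no nonzero maps to `A` or
  `A / s A`, which yields the vanishing of `Ext⁰` and `Ext¹`.
-/

noncomputable section

namespace CyclicGluing

/-! ### Power series and their restrictions to the coordinate axes -/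

section Axes

variable {k : Type*} [Field k] {σ : Type*}

/-- The restriction of a power series to the `i`-th coordinate axis, that is, the result of setting
all variables other than the `i`-th one equal to zero. -/
def axisRestrict (k : Type*) [Field k] (i : σ) : MvPowerSeries σ k →ₐ[k] PowerSeries k :=
  MvPowerSeries.killCompl (⟨fun _ => i, fun _ _ _ => rfl⟩ : Unit ↪ σ)

lemma coeff_axisRestrict (i : σ) (f : MvPowerSeries σ k) (n : ℕ) :
    PowerSeries.coeff n (axisRestrict k i f) = MvPowerSeries.coeff (Finsupp.single i n) f := by
  rw [PowerSeries.coeff, axisRestrict, MvPowerSeries.coeff_killCompl, Finsupp.embDomain_single]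
  rfl

lemma axisRestrict_X_self (i : σ) : axisRestrict k i (MvPowerSeries.X i) = PowerSeries.X :=
  MvPowerSeries.killCompl_X (e := (⟨fun _ => i, fun _ _ _ => rfl⟩ : Unit ↪ σ)) ()

lemma axisRestrict_X_of_ne {i j : σ} (h : j ≠ i) :
    axisRestrict k i (MvPowerSeries.X j) = 0 :=
  MvPowerSeries.killCompl_X_eq_zero fun ⟨_, hx⟩ => h hx.symm

lemma axisRestrict_C (i : σ) (c : k) :
    axisRestrict k i (MvPowerSeries.C c) = PowerSeries.C c :=
  MvPowerSeries.killCompl_C c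

lemma constantCoeff_axisRestrict (i : σ) (f : MvPowerSeries σ k) :
    PowerSeries.constantCoeff (axisRestrict k i f) = MvPowerSeries.constantCoeff f := by
  rw [← PowerSeries.coeff_zero_eq_constantCoeff_apply, coeff_axisRestrict, Finsupp.single_zero,
    MvPowerSeries.coeff_zero_eq_constantCoeff_apply]

/-- Power series on the coordinate axes with a common constant term glue to a power series in all
variables. -/
lemma exists_axisRestrict_eq (g : σ → PowerSeries k) (c : k)
    (hg : ∀ i, PowerSeries.constantCoeff (g i) = c) :
    ∃ f : MvPowerSeries σ k, ∀ i, axisRestrict k i f = g i := by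
  classical
  let f : MvPowerSeries σ k := fun n =>
    if h : ∃ i, n = Finsupp.single i (n i) then PowerSeries.coeff (n h.choose) (g h.choose) else 0
  refine ⟨f, fun i => PowerSeries.ext fun m => ?_⟩
  rw [coeff_axisRestrict]
  have h : ∃ j, Finsupp.single i m = Finsupp.single j (Finsupp.single i m j) := ⟨i, by simp⟩
  have hf : MvPowerSeries.coeff (Finsupp.single i m) f =
      PowerSeries.coeff (Finsupp.single i m h.choose) (g h.choose) := dif_pos h
  rw [hf]
  have hj := h.choose_spec
  generalize h.choose = j at hj
  rcases Finsupp.single_eq_single_iff _ _ _ _ |>.mp hj with ⟨h1, h2⟩ | ⟨h1, h2⟩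
  · rw [← h1, Finsupp.single_eq_same]
  · rw [h2, h1, PowerSeries.coeff_zero_eq_constantCoeff_apply,
      PowerSeries.coeff_zero_eq_constantCoeff_apply, hg, hg]

/-- A power series lies in the ideal generated by the products of two distinct variables if and
only if it vanishes on all coordinate axes. -/
lemma mem_span_X_mul_X_iff [Finite σ] [Nonempty σ] [LinearOrder σ] (f : MvPowerSeries σ k) :
    f ∈ Ideal.span {f : MvPowerSeries σ k |
      ∃ i j : σ, i < j ∧ f = MvPowerSeries.X i * MvPowerSeries.X j} ↔
      ∀ i, axisRestrict k i f = 0 := by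
  classical
  have := Fintype.ofFinite σ
  constructor
  · intro hf l
    change f ∈ RingHom.ker (axisRestrict k l).toRingHom
    refine (Ideal.span_le.mpr ?_ : Ideal.span _ ≤ _) hf
    rintro _ ⟨i, j, hij, rfl⟩
    change axisRestrict k l _ = 0
    rw [map_mul]
    rcases eq_or_ne i l with rfl | h
    · rw [axisRestrict_X_of_ne hij.ne', mul_zero]
    · rw [axisRestrict_X_of_ne h, zero_mul]
  · intro hf
    have hf' : ∀ i n, MvPowerSeries.coeff (Finsupp.single i n) f = 0 := fun i n => by
      rw [← coeff_axisRestrict, hf, map_zero]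
    -- every monomial of `f` is divisible by some `X i * X j` with `i < j`; choose such a pair
    have key : ∀ n : σ →₀ ℕ, ∃ p : σ × σ, MvPowerSeries.coeff n f ≠ 0 →
        p.1 < p.2 ∧ Finsupp.single p.1 1 + Finsupp.single p.2 1 ≤ n := by
      intro n
      by_cases hn : MvPowerSeries.coeff n f = 0
      · exact ⟨(Classical.arbitrary σ, Classical.arbitrary σ), fun h => absurd hn h⟩
      have h2 : 1 < n.support.card := by
        by_contra hcard
        rcases Finsupp.card_support_le_one.mp (not_lt.mp hcard) with ⟨i, hi⟩
        exact hn (hi ▸ hf' i _)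
      obtain ⟨i, j, hi, hj, hij⟩ := Finset.one_lt_card_iff.mp h2
      have aux : ∀ i j : σ, i ∈ n.support → j ∈ n.support → i < j →
          Finsupp.single i 1 + Finsupp.single j 1 ≤ n := by
        intro i j hi hj hij l
        rw [Finsupp.mem_support_iff] at hi hj
        rw [Finsupp.add_apply, Finsupp.single_apply, Finsupp.single_apply]
        split_ifs with h1 h2 h2
        · exact absurd (h1.trans h2.symm) hij.ne
        · subst h1; lia
        · subst h2; lia
        · lia
      rcases lt_or_gt_of_ne hij with h | h
      · exact ⟨(i, j), fun _ => ⟨h, aux i j hi hj h⟩⟩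
      · exact ⟨(j, i), fun _ => ⟨h, aux j i hj hi h⟩⟩
    choose p hp using key
    let e : σ × σ → σ →₀ ℕ := fun q => Finsupp.single q.1 1 + Finsupp.single q.2 1
    let g : σ × σ → MvPowerSeries σ k := fun q n =>
      if p (n + e q) = q then MvPowerSeries.coeff (n + e q) f else 0
    have hsum : f = ∑ q ∈ Finset.univ.filter (fun q : σ × σ => q.1 < q.2),
        MvPowerSeries.X q.1 * MvPowerSeries.X q.2 * g q := by
      ext n
      have hq : ∀ q : σ × σ, MvPowerSeries.coeff n (MvPowerSeries.X q.1 * MvPowerSeries.X q.2 * g q)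
          = if e q ≤ n then (if p n = q then MvPowerSeries.coeff n f else 0) else 0 := by
        intro q
        rw [MvPowerSeries.X, MvPowerSeries.X, MvPowerSeries.monomial_mul_monomial, mul_one,
          MvPowerSeries.coeff_monomial_mul]
        by_cases h1 : e q ≤ n
        · rw [if_pos h1, if_pos h1, one_mul]
          change (if p (n - e q + e q) = q then MvPowerSeries.coeff (n - e q + e q) f else 0) = _
          rw [tsub_add_cancel_of_le h1]
        · rw [if_neg h1, if_neg h1]
      rw [map_sum, Finset.sum_congr rfl fun q _ => hq q]
      by_cases hn : MvPowerSeries.coeff n f = 0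
      · simp [hn]
      · obtain ⟨h1, h2⟩ := hp n hn
        rw [Finset.sum_eq_single (p n)]
        · rw [if_pos h2, if_pos rfl]
        · intro q _ hqn
          rw [if_neg hqn.symm, ite_self]
        · intro h
          exact absurd (by simpa using h1) h
    rw [hsum]
    refine Ideal.sum_mem _ fun q hq => Ideal.mul_mem_right _ _ (Ideal.subset_span ?_)
    exact ⟨q.1, q.2, (Finset.mem_filter.mp hq).2, rfl⟩

end Axes

/-! ### The node and the ring of coordinate axes -/

section Node

variable {k : Type*} [Field k]

lemma branch_mk (b : Fin 2) (f : MvPowerSeries (Fin 2) k) :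
    branch k b (Ideal.Quotient.mk _ f) = axisRestrict k b f := rfl

/-- The normalization map of the node is injective. -/
lemma node_ext {x y : Node k} (h : ∀ b, branch k b x = branch k b y) : x = y := by
  obtain ⟨f, rfl⟩ := Ideal.Quotient.mk_surjective x
  obtain ⟨g, rfl⟩ := Ideal.Quotient.mk_surjective y
  rw [Ideal.Quotient.mk_eq_mk_iff_sub_mem]
  have h1 := (mem_span_X_mul_X_iff (f - g)).mpr fun b => by
    rw [map_sub, sub_eq_zero, ← branch_mk, ← branch_mk, h b]
  refine (Ideal.span_le.mpr ?_ : Ideal.span _ ≤ _) h1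
  rintro _ ⟨i, j, hij, rfl⟩
  have hi : i = 0 := by lia
  have hj : j = 1 := by lia
  subst hi hj
  exact Ideal.subset_span rfl

/-- The image of the normalization map of the node consists of all pairs of power series with the
same constant term. -/
lemma exists_branch_eq (g : Fin 2 → PowerSeries k)
    (hg : PowerSeries.constantCoeff (g 0) = PowerSeries.constantCoeff (g 1)) :
    ∃ x : Node k, ∀ b, branch k b x = g b := by
  obtain ⟨f, hf⟩ := exists_axisRestrict_eq g (PowerSeries.constantCoeff (g 1))
    (Fin.forall_fin_two.mpr ⟨hg, rfl⟩)
  exact ⟨Ideal.Quotient.mk _ f, hf⟩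

lemma constantCoeff_branch (b b' : Fin 2) (x : Node k) :
    PowerSeries.constantCoeff (branch k b x) = PowerSeries.constantCoeff (branch k b' x) := by
  obtain ⟨f, rfl⟩ := Ideal.Quotient.mk_surjective x
  rw [branch_mk, branch_mk, constantCoeff_axisRestrict, constantCoeff_axisRestrict]

lemma branch_nodeC (b : Fin 2) (c : k) : branch k b (nodeC k c) = PowerSeries.C c :=
  axisRestrict_C b c

lemma branch_zero_nodeU : branch k 0 (nodeU k) = PowerSeries.X := axisRestrict_X_self 0

lemma branch_one_nodeU : branch k 1 (nodeU k) = 0 := axisRestrict_X_of_ne (by decide)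

lemma branch_zero_nodeV : branch k 0 (nodeV k) = 0 := axisRestrict_X_of_ne (by decide)

lemma branch_one_nodeV : branch k 1 (nodeV k) = PowerSeries.X := axisRestrict_X_self 1

variable (k) in
/-- The ring homomorphism of the ring of coordinate axes to the product of the coordinate rings
of the axes. -/
def axesRestrict (t : ℕ) [NeZero t] : AxesRing k t →+* (Fin t → PowerSeries k) :=
  Ideal.Quotient.lift _ (RingHom.pi fun i => (axisRestrict k i).toRingHom) fun f hf =>
    funext ((mem_span_X_mul_X_iff f).mp hf)

variable {t : ℕ} [NeZero t]

lemma axesRestrict_mk (f : MvPowerSeries (Fin t) k) (i : Fin t) :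
    axesRestrict k t (Ideal.Quotient.mk _ f) i = axisRestrict k i f := rfl

lemma axesRestrict_injective : Function.Injective (axesRestrict k t) := by
  rw [injective_iff_map_eq_zero]
  intro x hx
  obtain ⟨f, rfl⟩ := Ideal.Quotient.mk_surjective x
  exact Ideal.Quotient.eq_zero_iff_mem.mpr ((mem_span_X_mul_X_iff f).mpr fun i => congrFun hx i)

lemma mem_range_axesRestrict_iff (g : Fin t → PowerSeries k) :
    g ∈ (axesRestrict k t).range ↔
      ∀ i j, PowerSeries.constantCoeff (g i) = PowerSeries.constantCoeff (g j) := by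
  constructor
  · rintro ⟨x, rfl⟩ i j
    obtain ⟨f, rfl⟩ := Ideal.Quotient.mk_surjective x
    rw [axesRestrict_mk, axesRestrict_mk, constantCoeff_axisRestrict, constantCoeff_axisRestrict]
  · intro h
    obtain ⟨f, hf⟩ := exists_axisRestrict_eq g _ fun i => h i 0
    exact ⟨Ideal.Quotient.mk _ f, funext hf⟩

lemma axesRestrict_axesC (c : k) : axesRestrict k t (axesC k t c) = fun _ => PowerSeries.C c :=
  funext fun i => axisRestrict_C i c

lemma axesRestrict_axesW (i : Fin t) :
    axesRestrict k t (axesW k i) = Pi.single i PowerSeries.X := by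
  funext j
  rcases eq_or_ne i j with rfl | h
  · rw [Pi.single_eq_same]
    exact axisRestrict_X_self i
  · rw [Pi.single_eq_of_ne h.symm]
    exact axisRestrict_X_of_ne h

end Node

/-! ### Finiteness along a conductor square -/

section Finiteness

/-- Over a ring `A` mapping onto `S ⧸ K`, the submodules of `S ⧸ K` are its ideals. -/
lemma isNoetherian_quotient_of_surjective {A S : Type*} [CommRing A] [CommRing S] [Algebra A S]
    (K : Ideal S) [IsNoetherianRing S] (h : Function.Surjective (algebraMap A (S ⧸ K))) :
    IsNoetherian A (S ⧸ K) := by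
  refine ⟨fun N => ?_⟩
  let N' : Ideal (S ⧸ K) :=
    { N.toAddSubmonoid with
      smul_mem' := fun c x hx => by
        obtain ⟨a, rfl⟩ := h c
        rw [smul_eq_mul, ← Algebra.smul_def]
        exact N.smul_mem a hx }
  exact (IsNoetherian.noetherian N').restrictScalars_of_surjective h

lemma isNoetherian_quotient_iInf {A S ι : Type*} [CommRing A] [CommRing S] [Algebra A S]
    [Finite ι] (K : ι → Ideal S) [∀ i, IsNoetherian A (S ⧸ K i)] :
    IsNoetherian A (S ⧸ ⨅ i, K i) := by
  refine isNoetherian_of_injective (R := A) (S := A) (P := ∀ i, S ⧸ K i)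
    (LinearMap.pi fun i => (Ideal.Quotient.factorₐ A (iInf_le K i)).toLinearMap) ?_
  rw [injective_iff_map_eq_zero]
  intro x hx
  obtain ⟨s, rfl⟩ := Ideal.Quotient.mk_surjective x
  rw [Ideal.Quotient.eq_zero_iff_mem, Ideal.mem_iInf]
  exact fun i => Ideal.Quotient.eq_zero_iff_mem.mp (congrFun hx i)

/-- If `S` is Noetherian and `K` is an ideal of `S` contained in the image of `A`, then `S` is
Noetherian over `A` as soon as `S ⧸ K` is. For an `A`-submodule `N` of `S`, the ideal `N S` is
generated by finitely many `n ∈ N`, and the submodule they generate over `A` contains `K N`. -/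
lemma isNoetherian_of_ideal_le_range {A S : Type*} [CommRing A] [CommRing S] [Algebra A S]
    [IsNoetherianRing S] (K : Ideal S) (hK : ∀ x ∈ K, x ∈ (algebraMap A S).range)
    [IsNoetherian A (S ⧸ K)] : IsNoetherian A S := by
  refine ⟨fun N => ?_⟩
  obtain ⟨T, hTN, hT⟩ := Submodule.fg_span_iff_fg_span_finset_subset (R := S) (N : Set S) |>.mp
    (IsNoetherian.noetherian _)
  let N₀ : Submodule A S := Submodule.span A (T : Set S)
  have hN₀ : N₀ ≤ N := Submodule.span_le.mpr hTN
  -- the quotient of `T S` by `N₀` is a sum of quotients of `S ⧸ K`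
  let θ : T → S →ₗ[A] S ⧸ N₀ := fun n => N₀.mkQ ∘ₗ LinearMap.mulRight A (n : S)
  have hθ : ∀ n : T, IsNoetherian A (LinearMap.range (θ n)) := fun n => by
    have hker : K.restrictScalars A ≤ LinearMap.ker (θ n) := fun x hx => by
      obtain ⟨a, rfl⟩ := hK x hx
      change N₀.mkQ (algebraMap A S a * n) = 0
      rw [← Algebra.smul_def, map_smul, Submodule.mkQ_apply,
        (Submodule.Quotient.mk_eq_zero _).mpr (Submodule.subset_span n.2), smul_zero]
    have : IsNoetherian A (S ⧸ K.restrictScalars A) :=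
      isNoetherian_of_linearEquiv (Submodule.Quotient.restrictScalarsEquiv A K).symm
    have h := isNoetherian_range ((K.restrictScalars A).liftQ (θ n) hker)
    rwa [Submodule.range_liftQ] at h
  have hsup : IsNoetherian A (⨆ n, LinearMap.range (θ n) : Submodule A (S ⧸ N₀)) := inferInstance
  refine Submodule.fg_of_fg_map_of_fg_inf_ker N₀.mkQ ?_ ?_
  · have hle : N.map N₀.mkQ ≤ ⨆ n, LinearMap.range (θ n) := by
      rintro _ ⟨x, hx, rfl⟩
      have hx' : x ∈ Submodule.span S (T : Set S) := hT ▸ Submodule.subset_span hx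
      obtain ⟨f, -, rfl⟩ := Submodule.mem_span_finset.mp hx'
      rw [map_sum]
      exact Submodule.sum_mem _ fun n hn =>
        Submodule.mem_iSup_of_mem (⟨n, hn⟩ : T) ⟨f n, rfl⟩
    exact isNoetherian_submodule.mp hsup _ hle
  · rw [Submodule.ker_mkQ, inf_eq_right.mpr hN₀]
    exact ⟨T, rfl⟩

end Finiteness

/-! ### Adic completeness -/

section Complete

/-- Completeness depends only on the topology: it passes from `K` to an ideal `J` with
`K ^ c ≤ J ≤ K`. -/
lemma isPrecomplete_of_pow_le {S : Type*} [CommRing S] {J K : Ideal S} (c : ℕ) (hJK : J ≤ K)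
    (hKJ : K ^ c ≤ J) [IsPrecomplete K S] : IsPrecomplete J S := by
  refine ⟨fun f hf => ?_⟩
  simp only [smul_eq_mul, Ideal.mul_top, SModEq.sub_mem] at hf ⊢
  obtain ⟨s, hs⟩ := IsPrecomplete.prec (I := K) (M := S) inferInstance (f := f) fun {m n} hmn => by
    simp only [smul_eq_mul, Ideal.mul_top, SModEq.sub_mem]
    exact Ideal.pow_right_mono hJK m (hf hmn)
  simp only [smul_eq_mul, Ideal.mul_top, SModEq.sub_mem] at hs
  refine ⟨s, fun n => ?_⟩
  have h1 : f (c * n + n) - s ∈ J ^ n :=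
    (Ideal.pow_le_pow_right (Nat.le_add_right _ _)).trans
      ((pow_mul K c n).le.trans (Ideal.pow_right_mono hKJ n)) (hs _)
  have h2 := Ideal.add_mem _ (hf (Nat.le_add_left n (c * n))) h1
  rwa [sub_add_sub_cancel] at h2

lemma mem_of_forall_mem_map_eval {ι : Type*} [Finite ι] {R : ι → Type*} [∀ i, CommRing (R i)]
    {J : Ideal (∀ i, R i)} {x : ∀ i, R i} (h : ∀ i, x i ∈ J.map (Pi.evalRingHom R i)) :
    x ∈ J := by
  rw [← Ideal.piOrderIso.symm_apply_apply J]
  exact h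

lemma isPrecomplete_pi {ι : Type*} [Finite ι] {R : ι → Type*} [∀ i, CommRing (R i)]
    (J : Ideal (∀ i, R i)) [∀ i, IsPrecomplete (J.map (Pi.evalRingHom R i)) (R i)] :
    IsPrecomplete J (∀ i, R i) := by
  refine ⟨fun f hf => ?_⟩
  simp only [smul_eq_mul, Ideal.mul_top, SModEq.sub_mem] at hf ⊢
  have h : ∀ i, ∃ s : R i, ∀ n, f n i - s ∈ J.map (Pi.evalRingHom R i) ^ n := fun i => by
    have := IsPrecomplete.prec (I := J.map (Pi.evalRingHom R i)) (M := R i) inferInstance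
      (f := fun n => f n i) fun {m n} hmn => by
        simp only [smul_eq_mul, Ideal.mul_top, SModEq.sub_mem, ← Ideal.map_pow]
        exact Ideal.mem_map_of_mem (Pi.evalRingHom R i) (hf hmn)
    simpa only [smul_eq_mul, Ideal.mul_top, SModEq.sub_mem] using this
  choose s hs using h
  refine ⟨s, fun n => mem_of_forall_mem_map_eval fun i => ?_⟩
  rw [Ideal.map_pow]
  exact hs i n

/-- A submodule of a finite module over a Noetherian local ring is closed by Krull's intersection
theorem, and it carries the subspace topology by the Artin–Rees lemma. Hence it is complete if the
module is. -/
lemma isPrecomplete_of_injective {A M N : Type*} [CommRing A] [IsNoetherianRing A] [IsLocalRing A]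
    [AddCommGroup M] [Module A M] [Module.Finite A M] [AddCommGroup N] [Module A N]
    [IsPrecomplete (IsLocalRing.maximalIdeal A) M] (g : N →ₗ[A] M) (hg : Function.Injective g) :
    IsPrecomplete (IsLocalRing.maximalIdeal A) N := by
  set m := IsLocalRing.maximalIdeal A
  refine ⟨fun f hf => ?_⟩
  simp only [SModEq.sub_mem] at hf ⊢
  have hmem : ∀ n (y : N), y ∈ (m ^ n • ⊤ : Submodule A N) ↔ g y ∈ m ^ n • LinearMap.range g := by
    intro n y
    rw [← Submodule.map_top, ← Submodule.map_smul'', ← Submodule.mem_comap,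
      Submodule.comap_map_eq_of_injective hg]
  obtain ⟨s, hs⟩ := IsPrecomplete.prec (I := m) (M := M) inferInstance (f := fun n => g (f n))
    fun {i j} hij => by
      rw [SModEq.sub_mem, ← map_sub]
      exact Submodule.smul_mono le_rfl le_top ((hmem _ _).mp (hf hij))
  simp only [SModEq.sub_mem] at hs
  obtain ⟨s, rfl⟩ : s ∈ LinearMap.range g := by
    rw [← Submodule.Quotient.mk_eq_zero]
    refine IsHausdorff.haus (I := m) (M := M ⧸ LinearMap.range g) inferInstance _ fun n => ?_
    rw [SModEq.sub_mem, sub_zero]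
    have h1 := Submodule.mem_map_of_mem (f := (LinearMap.range g).mkQ) (hs n)
    have h2 : (LinearMap.range g).mkQ (g (f n)) = 0 :=
      (Submodule.Quotient.mk_eq_zero _).mpr ⟨f n, rfl⟩
    rw [map_sub, h2, zero_sub, neg_mem_iff, Submodule.map_smul''] at h1
    exact Submodule.smul_mono le_rfl le_top h1
  obtain ⟨c, hc⟩ := Ideal.exists_pow_inf_eq_pow_smul m (LinearMap.range g)
  refine ⟨s, fun n => ?_⟩
  have h1 : f (n + c) - s ∈ (m ^ n • ⊤ : Submodule A N) := by
    rw [hmem]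
    have h2 : g (f (n + c) - s) ∈ m ^ (n + c) • (⊤ : Submodule A M) ⊓ LinearMap.range g :=
      ⟨map_sub g _ _ ▸ hs _, ⟨_, rfl⟩⟩
    rw [hc _ (Nat.le_add_left _ _), Nat.add_sub_cancel] at h2
    exact Submodule.smul_mono le_rfl inf_le_right h2
  have h2 := Submodule.add_mem _ (hf (Nat.le_add_right n c)) h1
  rwa [sub_add_sub_cancel] at h2

end Complete

/-! ### Dimension and depth -/

section Dimension

/-- If the maps of `A` to finitely many integral `A`-algebras of dimension `d` are jointly
injective, then `A` has dimension `d`: every prime of `A` contains the kernel of one of them. -/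
lemma ringKrullDim_eq_of_isIntegral {A ι : Type*} [CommRing A] [Finite ι] [Nonempty ι]
    (R : ι → Type*) [∀ i, CommRing (R i)] [∀ i, Algebra A (R i)]
    [∀ i, Algebra.IsIntegral A (R i)] (hA : ∀ a : A, (∀ i, algebraMap A (R i) a = 0) → a = 0)
    (d : WithBot ℕ∞) (hd : ∀ i, ringKrullDim (R i) = d) : ringKrullDim A = d := by
  have := Fintype.ofFinite ι
  apply le_antisymm
  · refine iSup_le fun l => ?_
    obtain ⟨i, hi⟩ : ∃ i, RingHom.ker (algebraMap A (R i)) ≤ l.head.asIdeal := by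
      have h : Finset.univ.inf (fun i => RingHom.ker (algebraMap A (R i))) ≤ l.head.asIdeal := by
        intro a ha
        rw [Submodule.mem_finsetInf] at ha
        rw [hA a fun i => ha i (Finset.mem_univ i)]
        exact zero_mem _
      simpa using l.head.isPrime.inf_le'.mp h
    obtain ⟨P, -, hP, hPl⟩ := Ideal.exists_ideal_over_prime_of_isIntegral l.head.asIdeal
      (⊥ : Ideal (R i)) hi
    have : P.LiesOver l.head.asIdeal := ⟨hPl.symm⟩
    obtain ⟨L, hL, -⟩ := Ideal.exists_ltSeries_of_hasGoingUp l P
    rw [← hd i, ← hL]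
    exact le_iSup (fun p : LTSeries (PrimeSpectrum (R i)) => (p.length : WithBot ℕ∞)) L
  · obtain ⟨i⟩ := ‹Nonempty ι›
    rw [← hd i]
    exact Order.krullDim_le_of_strictMono (PrimeSpectrum.comap (algebraMap A (R i)))
      fun p q hpq => Ideal.IsIntegral.comap_lt_comap hpq

/-- An elementwise criterion for depth at least two. As `r` is regular and kills the residue field
`κ`, there are no nonzero maps `κ → A`, and `Ext¹(κ, A)` is a quotient of `Hom(κ, A ⧸ r A)`; the
assumption `h` says that the latter vanishes. -/
lemma subsingleton_ext_residueField {A : Type*} [CommRing A] [IsLocalRing A] {r : A}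
    (hr : r ∈ IsLocalRing.maximalIdeal A) (hreg : r ∈ nonZeroDivisors A)
    (h : ∀ z : A, (∀ a ∈ IsLocalRing.maximalIdeal A, r ∣ a * z) → r ∣ z) {i : ℕ} (hi : i < 2) :
    Subsingleton (CategoryTheory.Abelian.Ext
      (ModuleCat.of A (IsLocalRing.ResidueField A)) (ModuleCat.of A A) i) := by
  have hsmul : ∀ a ∈ IsLocalRing.maximalIdeal A, ∀ y : IsLocalRing.ResidueField A, a • y = 0 := by
    intro a ha y
    rw [Algebra.smul_def, IsLocalRing.ResidueField.algebraMap_eq,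
      (IsLocalRing.residue_eq_zero_iff a).mpr ha, zero_mul]
  -- a linear map on the residue field is determined by its value at `1`
  have hlin : ∀ {M : Type _} [AddCommGroup M] [Module A M]
      (f : IsLocalRing.ResidueField A →ₗ[A] M), f 1 = 0 → f = 0 := by
    intro M _ _ f hf
    ext y
    obtain ⟨a, rfl⟩ := IsLocalRing.residue_surjective y
    rw [← IsLocalRing.ResidueField.algebraMap_eq, Algebra.algebraMap_eq_smul_one, map_smul, hf,
      smul_zero, LinearMap.zero_apply]
  have hzero : ∀ f : IsLocalRing.ResidueField A →ₗ[A] A, f = 0 := fun f => hlin f <| by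
    refine (mul_left_mem_nonZeroDivisors_eq_zero_iff hreg).mp ?_
    rw [← smul_eq_mul, ← map_smul, hsmul r hr, map_zero]
  have hone : ∀ f : IsLocalRing.ResidueField A →ₗ[A] QuotSMulTop r A, f = 0 := fun f => hlin f <| by
    obtain ⟨z, hz⟩ := Submodule.mkQ_surjective _ (f 1)
    have hdvd : ∀ y : A, (Submodule.mkQ _ y : QuotSMulTop r A) = 0 ↔ r ∣ y := fun y => by
      rw [Submodule.mkQ_apply, Submodule.Quotient.mk_eq_zero,
        Submodule.mem_smul_pointwise_iff_exists]
      simp [Dvd.dvd, eq_comm]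
    rw [← hz, hdvd]
    refine h z fun a ha => ?_
    rw [← hdvd, ← smul_eq_mul, map_smul, hz, ← map_smul, hsmul a ha, map_zero]
  obtain rfl | rfl : i = 0 ∨ i = 1 := by lia
  · have : Subsingleton (IsLocalRing.ResidueField A →ₗ[A] A) :=
      ⟨fun f g => (hzero f).trans (hzero g).symm⟩
    exact (CategoryTheory.Abelian.Ext.addEquiv₀.trans ModuleCat.homAddEquiv).subsingleton
  · have : Subsingleton (IsLocalRing.ResidueField A →ₗ[A] QuotSMulTop r A) :=
      ⟨fun f g => (hone f).trans (hone g).symm⟩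
    have h0 : Subsingleton (CategoryTheory.Abelian.Ext
        (ModuleCat.of A (IsLocalRing.ResidueField A)) (ModuleCat.of A (QuotSMulTop r A)) 0) :=
      (CategoryTheory.Abelian.Ext.addEquiv₀.trans ModuleCat.homAddEquiv).subsingleton
    have hreg' : IsSMulRegular (ModuleCat.of A A) r :=
      fun x y hxy => (mul_cancel_left_mem_nonZeroDivisors hreg).mp hxy
    refine subsingleton_of_forall_eq 0 fun x => ?_
    -- multiplication by `r` kills `x`, so `x` comes from a homomorphism to `A ⧸ r A`
    have hx : x.comp (CategoryTheory.Abelian.Ext.mk₀ ((ModuleCat.of A A).smulShortComplex r).f)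
        (add_zero 1) = 0 :=
      DFunLike.congr_fun (AddCommGrpCat.hom_ext_iff.mp
        (CategoryTheory.Abelian.Ext.postcomp_smul_id_eq_zero_of_mem_annihilator
          (Module.mem_annihilator.mpr (hsmul r hr)) 1)) x
    obtain ⟨y, rfl⟩ := CategoryTheory.Abelian.Ext.covariant_sequence_exact₁ _
      hreg'.smulShortComplex_shortExact x hx (zero_add 1)
    have hy : y = 0 := @Subsingleton.elim _ h0 _ _
    rw [hy, CategoryTheory.Abelian.Ext.zero_comp]
    rfl

/-- In a Noetherian normal local domain of dimension at least two, an element of the fraction field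
that multiplies the maximal ideal into the ring lies in the ring: otherwise it would multiply the
maximal ideal either into itself, making it integral, or onto the ring, making the maximal ideal
principal. -/
lemma mem_range_of_forall_maximalIdeal_mul_mem {S K : Type*} [CommRing S] [IsDomain S]
    [IsIntegrallyClosed S] [IsNoetherianRing S] [IsLocalRing S] (hS : 1 < ringKrullDim S)
    [Field K] [Algebra S K] [IsFractionRing S K] {y : K}
    (hy : ∀ a ∈ IsLocalRing.maximalIdeal S, algebraMap S K a * y ∈ (algebraMap S K).range) :
    y ∈ (algebraMap S K).range := by
  have hnf : ¬ IsField S := fun h => by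
    rw [ringKrullDim_eq_zero_of_isField h] at hS
    exact absurd hS (by decide)
  by_cases h : ∀ a ∈ IsLocalRing.maximalIdeal S, ∀ b, algebraMap S K a * y = algebraMap S K b →
      b ∈ IsLocalRing.maximalIdeal S
  · refine IsIntegrallyClosed.isIntegral_iff.mp (isIntegral_of_smul_mem_submodule
      (M := K) (Submodule.map (Algebra.linearMap S K) (IsLocalRing.maximalIdeal S)) ?_
      ((IsNoetherian.noetherian _).map _) y ?_)
    · exact fun hbot => hnf (IsLocalRing.isField_iff_maximalIdeal_eq.mpr
        (Submodule.map_injective_of_injective (f := Algebra.linearMap S K)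
          (IsFractionRing.injective S K) (hbot.trans (Submodule.map_bot _).symm)))
    · rintro _ ⟨a, ha, rfl⟩
      obtain ⟨b, hb⟩ := hy a ha
      refine ⟨b, h a ha b hb.symm, ?_⟩
      rw [Algebra.linearMap_apply, hb, smul_eq_mul, mul_comm, Algebra.linearMap_apply]
  · push Not at h
    obtain ⟨a, ha, b, hab, hb⟩ := h
    obtain ⟨u, rfl⟩ : IsUnit b := IsLocalRing.notMem_maximalIdeal.mp hb
    have hy1 : y * algebraMap S K (a * ↑u⁻¹) = 1 := by
      rw [map_mul, ← mul_assoc, mul_comm y, hab, ← map_mul, Units.mul_inv, map_one]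
    have hspan : IsLocalRing.maximalIdeal S = Ideal.span {a * ↑u⁻¹} := by
      refine le_antisymm (fun c hc => ?_)
        ((Ideal.span_singleton_le_iff_mem _).mpr (Ideal.mul_mem_right _ _ ha))
      obtain ⟨d, hd⟩ := hy c hc
      refine Ideal.mem_span_singleton'.mpr ⟨d, IsFractionRing.injective S K ?_⟩
      rw [map_mul, hd, mul_assoc, hy1, mul_one]
    have : (IsLocalRing.maximalIdeal S).IsPrincipal := ⟨_, hspan⟩
    have hht := Ideal.height_le_one_of_isPrincipal_of_mem_minimalPrimes
      (IsLocalRing.maximalIdeal S) (IsLocalRing.maximalIdeal S) (by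
        rw [Ideal.minimalPrimes_eq_subsingleton_self]; rfl)
    rw [← IsLocalRing.maximalIdeal_height_eq_ringKrullDim] at hS
    exact absurd (WithBot.coe_le_coe.mpr hht) (not_le.mpr hS)

end Dimension

section Gluing

variable {k : Type*} [Field k] {t : ℕ} {R : Fin t → Type*} [∀ i, CommRing (R i)]

/-! ### Branches of the glued ring -/

/-- The restriction of a tuple to the `b`-th branch of its `i`-th component. -/
def branchAt (π : ∀ i, R i →+* Node k) (i : Fin t) (b : Fin 2) : (∀ i, R i) →+* PowerSeries k :=
  (branch k b).comp ((π i).comp (Pi.evalRingHom R i))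

variable {π : ∀ i, R i →+* Node k}

lemma mem_kerIdeal_iff {r : ∀ i, R i} :
    r ∈ kerIdeal π ↔ ∀ i b, branchAt π i b r = 0 := by
  refine (Ideal.mem_pi _ _).trans (forall_congr' fun i => ⟨fun h b => ?_, fun h => ?_⟩)
  · rw [RingHom.mem_ker] at h
    change branch k b (π i (r i)) = 0
    rw [h, map_zero]
  · exact node_ext fun b => (h b).trans (map_zero _).symm

lemma constantCoeff_branchAt (i : Fin t) (b b' : Fin 2) (r : ∀ i, R i) :
    PowerSeries.constantCoeff (branchAt π i b r) =
      PowerSeries.constantCoeff (branchAt π i b' r) :=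
  constantCoeff_branch b b' _

lemma exists_branchAt_eq (hπ : ∀ i, Function.Surjective (π i))
    (g : Fin t → Fin 2 → PowerSeries k)
    (hg : ∀ i, PowerSeries.constantCoeff (g i 0) = PowerSeries.constantCoeff (g i 1)) :
    ∃ r : ∀ i, R i, ∀ i b, branchAt π i b r = g i b := by
  choose x hx using fun i => exists_branch_eq (g i) (hg i)
  choose r hr using fun i => hπ i (x i)
  refine ⟨r, fun i b => ?_⟩
  change branch k b (π i (r i)) = g i b
  rw [hr, hx]

/-- The maximal ideal of `R i` can be read off from the constant term of either branch. -/
lemma mem_maximalIdeal_iff_constantCoeff [∀ i, IsLocalRing (R i)]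
    (hπ : ∀ i, Function.Surjective (π i)) (i : Fin t) (b : Fin 2) (r : ∀ i, R i) :
    r i ∈ IsLocalRing.maximalIdeal (R i) ↔
      PowerSeries.constantCoeff (branchAt π i b r) = 0 := by
  let ε : R i →+* k := PowerSeries.constantCoeff.comp ((branch k b).comp (π i))
  have hε : Function.Surjective ε := fun c => by
    obtain ⟨x, hx⟩ := hπ i (nodeC k c)
    refine ⟨x, ?_⟩
    change PowerSeries.constantCoeff (branch k b (π i x)) = c
    rw [hx, branch_nodeC, PowerSeries.constantCoeff_C]
  have := RingHom.ker_isMaximal_of_surjective ε hε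
  rw [← IsLocalRing.eq_maximalIdeal this]
  exact RingHom.mem_ker

/-- The product of two tuples of elements of the maximal ideals is, modulo the conductor, a
multiple of any element of the glued ring that restricts to the coordinate on every branch. -/
lemma exists_mul_sub_mul_mem_kerIdeal [∀ i, IsLocalRing (R i)]
    (hπ : ∀ i, Function.Surjective (π i))
    {τ : ∀ i, R i} (hτ : ∀ i b, branchAt π i b τ = PowerSeries.X) {x y : ∀ i, R i}
    (hx : ∀ i, x i ∈ IsLocalRing.maximalIdeal (R i))
    (hy : ∀ i, y i ∈ IsLocalRing.maximalIdeal (R i)) :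
    ∃ z, x * y - τ * z ∈ kerIdeal π := by
  have hX : ∀ i b, PowerSeries.X ∣ branchAt π i b x := fun i b =>
    PowerSeries.X_dvd_iff.mpr ((mem_maximalIdeal_iff_constantCoeff hπ i b x).mp (hx i))
  choose g hg using hX
  have hy0 : ∀ i b, PowerSeries.constantCoeff (branchAt π i b y) = 0 := fun i b =>
    (mem_maximalIdeal_iff_constantCoeff hπ i b y).mp (hy i)
  obtain ⟨z, hz⟩ := exists_branchAt_eq hπ (fun i b => g i b * branchAt π i b y) fun i => by
    rw [map_mul, map_mul, hy0, hy0, mul_zero, mul_zero]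
  refine ⟨z, mem_kerIdeal_iff.mpr fun i b => ?_⟩
  rw [map_sub, map_mul, map_mul, hτ, hz, hg, mul_assoc, sub_self]

variable [NeZero t]

lemma mem_gluedRing_iff {r : ∀ i, R i} :
    r ∈ gluedRing π ↔ ∀ i, branchAt π i 1 r = branchAt π (i + 1) 0 r := Iff.rfl

lemma kerIdeal_le_gluedRing {r : ∀ i, R i} (hr : r ∈ kerIdeal π) : r ∈ gluedRing π := fun i =>
  (mem_kerIdeal_iff.mp hr i 1).trans (mem_kerIdeal_iff.mp hr (i + 1) 0).symm

/-- Elements of the glued ring have a single constant term: it propagates around the cycle. -/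
lemma constantCoeff_branchAt_eq {a : ∀ i, R i} (ha : a ∈ gluedRing π) (i j : Fin t)
    (b b' : Fin 2) : PowerSeries.constantCoeff (branchAt π i b a) =
      PowerSeries.constantCoeff (branchAt π j b' a) := by
  have hsucc : ∀ i, PowerSeries.constantCoeff (branchAt π (i + 1) 0 a) =
      PowerSeries.constantCoeff (branchAt π i 0 a) := fun i => by
    rw [← mem_gluedRing_iff.mp ha i, constantCoeff_branchAt i 1 0]
  have hzero : ∀ i, PowerSeries.constantCoeff (branchAt π i 0 a) =
      PowerSeries.constantCoeff (branchAt π 0 0 a) := by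
    obtain ⟨n, rfl⟩ := Nat.exists_eq_succ_of_ne_zero (NeZero.ne t)
    intro i
    induction i using Fin.induction with
    | zero => rfl
    | succ i ih => rw [← Fin.coeSucc_eq_succ, hsucc, ih]
  rw [constantCoeff_branchAt i b 0, constantCoeff_branchAt j b' 0, hzero i, hzero j]

/-- Power series with a common constant term can be prescribed on the glued branches. -/
lemma exists_mem_gluedRing (hπ : ∀ i, Function.Surjective (π i)) (h : Fin t → PowerSeries k)
    (hh : ∀ i j, PowerSeries.constantCoeff (h i) = PowerSeries.constantCoeff (h j)) :
    ∃ a ∈ gluedRing π, ∀ i, branchAt π i 1 a = h i ∧ branchAt π (i + 1) 0 a = h i := by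
  obtain ⟨a, ha⟩ := exists_branchAt_eq hπ (fun i b => if b = 1 then h i else h (i - 1))
    fun i => by simpa using hh _ _
  have h1 : ∀ i, branchAt π i 1 a = h i := fun i => by rw [ha, if_pos rfl]
  have h0 : ∀ i, branchAt π (i + 1) 0 a = h i := fun i => by
    rw [ha, if_neg (by decide), add_sub_cancel_right]
  exact ⟨a, fun i => (h1 i).trans (h0 i).symm, fun i => ⟨h1 i, h0 i⟩⟩

/-- Every power series occurs as the common restriction of an element of the glued ring to all
branches. -/
lemma exists_mem_gluedRing_forall_branchAt_eq (hπ : ∀ i, Function.Surjective (π i))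
    (p : PowerSeries k) : ∃ a ∈ gluedRing π, ∀ i b, branchAt π i b a = p := by
  obtain ⟨a, ha⟩ := exists_branchAt_eq hπ (fun _ _ => p) fun _ => rfl
  exact ⟨a, fun i => (ha _ _).trans (ha _ _).symm, ha⟩

/-- An element of the glued ring is determined modulo the conductor by its `v`-branches. -/
lemma mem_kerIdeal_iff_of_mem_gluedRing {a : ∀ i, R i} (ha : a ∈ gluedRing π) :
    a ∈ kerIdeal π ↔ ∀ i, branchAt π i 1 a = 0 := by
  refine mem_kerIdeal_iff.trans ⟨fun h i => h i 1, fun h i => Fin.forall_fin_two.mpr ⟨?_, h i⟩⟩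
  rw [← sub_add_cancel i 1, ← mem_gluedRing_iff.mp ha, h]

/-- The kernel of `π` is the conductor of the glued ring. -/
lemma mem_kerIdeal_iff_forall_mul_mem (hπ : ∀ i, Function.Surjective (π i)) {c : ∀ i, R i} :
    c ∈ kerIdeal π ↔ ∀ r, c * r ∈ gluedRing π := by
  classical
  refine ⟨fun h r => kerIdeal_le_gluedRing (Ideal.mul_mem_right r _ h), fun h => ?_⟩
  have hc : c ∈ gluedRing π := by simpa using h 1
  refine (mem_kerIdeal_iff_of_mem_gluedRing hc).mpr fun i => ?_
  -- test against an element supported on the `v`-branch of the `i`-th component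
  obtain ⟨r, hr⟩ := exists_branchAt_eq hπ
    (fun j b => if j = i ∧ b = 1 then PowerSeries.X else 0) fun j => by
      by_cases hj : j = i <;> simp [hj]
  have h1 := h r i
  change branchAt π i 1 (c * r) = branchAt π (i + 1) 0 (c * r) at h1
  rw [map_mul, map_mul, hr, hr, if_pos ⟨rfl, rfl⟩, if_neg (by simp), mul_zero] at h1
  exact (mul_eq_zero.mp h1).resolve_right PowerSeries.X_ne_zero

/-! ### The glued ring is Noetherian and local -/

/-- The product is Noetherian over the glued ring: modulo the conductor it embeds into the product
of the rings of the branches, each of which is a quotient of the glued ring. -/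
lemma isNoetherian_gluedRing_pi [∀ i, IsNoetherianRing (R i)]
    (hπ : ∀ i, Function.Surjective (π i)) : IsNoetherian (gluedRing π) (∀ i, R i) := by
  have hK : ∀ q : Fin t × Fin 2, IsNoetherian (gluedRing π)
      ((∀ i, R i) ⧸ RingHom.ker (branchAt π q.1 q.2)) := fun q => by
    refine isNoetherian_quotient_of_surjective _ fun x => ?_
    obtain ⟨r, rfl⟩ := Ideal.Quotient.mk_surjective x
    obtain ⟨a, ha, hab⟩ := exists_mem_gluedRing_forall_branchAt_eq hπ (branchAt π q.1 q.2 r)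
    refine ⟨⟨a, ha⟩, Ideal.Quotient.eq.mpr ?_⟩
    rw [RingHom.mem_ker, map_sub, sub_eq_zero]
    exact hab _ _
  have := isNoetherian_quotient_iInf (A := gluedRing π)
    fun q : Fin t × Fin 2 => RingHom.ker (branchAt π q.1 q.2)
  refine isNoetherian_of_ideal_le_range (⨅ q : Fin t × Fin 2, RingHom.ker (branchAt π q.1 q.2))
    fun x hx => ⟨⟨x, kerIdeal_le_gluedRing ?_⟩, rfl⟩
  exact mem_kerIdeal_iff.mpr fun i b => (Ideal.mem_iInf.mp hx) (i, b)

lemma isNoetherianRing_gluedRing [∀ i, IsNoetherianRing (R i)]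
    (hπ : ∀ i, Function.Surjective (π i)) : IsNoetherianRing (gluedRing π) := by
  have := isNoetherian_gluedRing_pi hπ
  exact isNoetherian_of_injective (Algebra.linearMap (gluedRing π) (∀ i, R i))
    Subtype.val_injective

variable [∀ i, IsLocalRing (R i)]

lemma isUnit_of_constantCoeff_ne_zero (hπ : ∀ i, Function.Surjective (π i)) {i : Fin t}
    {b : Fin 2} (a : gluedRing π) (ha : PowerSeries.constantCoeff (branchAt π i b a) ≠ 0) :
    IsUnit a := by
  have hunit : ∀ j, ∃ y : R j, (a : ∀ i, R i) j * y = 1 := fun j => by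
    rw [← isUnit_iff_exists_inv, ← IsLocalRing.notMem_maximalIdeal,
      mem_maximalIdeal_iff_constantCoeff hπ j b, constantCoeff_branchAt_eq a.2 j i b b]
    exact ha
  choose y hy using hunit
  have hay : (a : ∀ i, R i) * y = 1 := funext hy
  have hb : ∀ j b, branchAt π j b a * branchAt π j b y = 1 := fun j b => by
    rw [← map_mul, hay, map_one]
  refine isUnit_iff_exists_inv.mpr ⟨⟨y, fun j => ?_⟩, Subtype.ext hay⟩
  refine left_inv_eq_right_inv (a := branchAt π j 1 a) ?_ ?_
  · rw [mul_comm]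
    exact hb j 1
  · rw [mem_gluedRing_iff.mp a.2 j]
    exact hb (j + 1) 0

lemma isLocalRing_gluedRing (hπ : ∀ i, Function.Surjective (π i)) :
    IsLocalRing (gluedRing π) := by
  let ε : gluedRing π →+* k :=
    PowerSeries.constantCoeff.comp ((branchAt π 0 0).comp (gluedRing π).subtype)
  have : IsLocalHom ε := ⟨fun a ha => isUnit_of_constantCoeff_ne_zero hπ a ha.ne_zero⟩
  exact RingHom.domain_isLocalRing ε

lemma mem_maximalIdeal_gluedRing_iff [IsLocalRing (gluedRing π)]
    (hπ : ∀ i, Function.Surjective (π i)) {a : gluedRing π} :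
    a ∈ IsLocalRing.maximalIdeal (gluedRing π) ↔
      ∀ i, (a : ∀ i, R i) i ∈ IsLocalRing.maximalIdeal (R i) := by
  constructor
  · intro ha i
    rw [mem_maximalIdeal_iff_constantCoeff hπ i 0]
    by_contra h
    exact ha (isUnit_of_constantCoeff_ne_zero hπ a h)
  · intro ha hu
    exact ha 0 (hu.map ((Pi.evalRingHom R 0).comp (gluedRing π).subtype))

lemma mem_maximalIdeal_of_mem_kerIdeal [IsLocalRing (gluedRing π)]
    (hπ : ∀ i, Function.Surjective (π i)) {e : ∀ i, R i} (he : e ∈ kerIdeal π) :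
    (⟨e, kerIdeal_le_gluedRing he⟩ : gluedRing π) ∈ IsLocalRing.maximalIdeal (gluedRing π) :=
  (mem_maximalIdeal_gluedRing_iff hπ).mpr fun i => by
    rw [mem_maximalIdeal_iff_constantCoeff hπ i 0, mem_kerIdeal_iff.mp he, map_zero]

/-- The maximal ideal contains an element restricting to the coordinate on every branch. -/
lemma exists_mem_maximalIdeal_forall_branchAt_eq_X [IsLocalRing (gluedRing π)]
    (hπ : ∀ i, Function.Surjective (π i)) :
    ∃ τ ∈ IsLocalRing.maximalIdeal (gluedRing π), ∀ i b, branchAt π i b τ = PowerSeries.X := by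
  obtain ⟨τ, hτA, hτ⟩ := exists_mem_gluedRing_forall_branchAt_eq hπ (PowerSeries.X (R := k))
  refine ⟨⟨τ, hτA⟩, (mem_maximalIdeal_gluedRing_iff hπ).mpr fun i => ?_, hτ⟩
  rw [mem_maximalIdeal_iff_constantCoeff hπ i 0, hτ, PowerSeries.constantCoeff_X]

/-- The square of the maximal ideal of `R i` is contained in the extension of the maximal ideal of
the glued ring. -/
lemma exists_mul_eq_add_mul [IsLocalRing (gluedRing π)] (hπ : ∀ i, Function.Surjective (π i))
    {i : Fin t} {x y : R i} (hx : x ∈ IsLocalRing.maximalIdeal (R i))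
    (hy : y ∈ IsLocalRing.maximalIdeal (R i)) :
    ∃ a ∈ IsLocalRing.maximalIdeal (gluedRing π), ∃ e ∈ IsLocalRing.maximalIdeal (gluedRing π),
      ∃ c : R i, x * y = (e : ∀ i, R i) i + (a : ∀ i, R i) i * c := by
  classical
  obtain ⟨τ, hτm, hτ⟩ := exists_mem_maximalIdeal_forall_branchAt_eq_X hπ
  have hsingle : ∀ x : R i, x ∈ IsLocalRing.maximalIdeal (R i) → ∀ j,
      (Pi.single i x : ∀ i, R i) j ∈ IsLocalRing.maximalIdeal (R j) := by
    intro x hx j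
    rcases eq_or_ne j i with rfl | h
    · rwa [Pi.single_eq_same]
    · rw [Pi.single_eq_of_ne h]
      exact zero_mem _
  obtain ⟨c, hc⟩ := exists_mul_sub_mul_mem_kerIdeal hπ hτ (hsingle x hx) (hsingle y hy)
  exact ⟨τ, hτm, _, mem_maximalIdeal_of_mem_kerIdeal hπ hc, c i, by simp⟩

/-- The maximal ideal of the glued ring defines the product of the adic topologies on `∏ i, R i`, in
which the product is complete; the glued ring is closed in it. -/
lemma isAdicComplete_gluedRing [∀ i, IsNoetherianRing (R i)]
    [∀ i, IsAdicComplete (IsLocalRing.maximalIdeal (R i)) (R i)]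
    [IsLocalRing (gluedRing π)] (hπ : ∀ i, Function.Surjective (π i)) :
    IsAdicComplete (IsLocalRing.maximalIdeal (gluedRing π)) (gluedRing π) := by
  have := isNoetherianRing_gluedRing hπ
  have := isNoetherian_gluedRing_pi hπ
  set m := IsLocalRing.maximalIdeal (gluedRing π)
  set J : Ideal (∀ i, R i) := m.map (algebraMap (gluedRing π) (∀ i, R i))
  have hmem : ∀ a : gluedRing π, a ∈ m → ∀ i,
      (a : ∀ i, R i) i ∈ J.map (Pi.evalRingHom R i) := fun a ha i =>
    Ideal.mem_map_of_mem (Pi.evalRingHom R i) (Ideal.mem_map_of_mem _ ha)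
  have hJ : ∀ i, IsPrecomplete (J.map (Pi.evalRingHom R i)) (R i) := fun i => by
    refine isPrecomplete_of_pow_le (K := IsLocalRing.maximalIdeal (R i)) 2 ?_ ?_
    · rw [Ideal.map_map, Ideal.map_le_iff_le_comap]
      exact fun a ha => (mem_maximalIdeal_gluedRing_iff hπ).mp ha i
    · rw [pow_two, Ideal.mul_le]
      intro x hx y hy
      obtain ⟨a, ha, e, he, c, hxy⟩ := exists_mul_eq_add_mul hπ hx hy
      rw [hxy]
      exact Ideal.add_mem _ (hmem _ he i) (Ideal.mul_mem_right _ _ (hmem _ ha i))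
  have : IsPrecomplete m (∀ i, R i) := IsPrecomplete.map_algebraMap_iff.mp (isPrecomplete_pi J)
  have := isPrecomplete_of_injective (Algebra.linearMap (gluedRing π) (∀ i, R i))
    Subtype.val_injective
  exact {}

end Gluing

section ConductorAndDepth

variable {k : Type*} [Field k] {t : ℕ} {R : Fin t → Type*} [∀ i, CommRing (R i)]
  {π : ∀ i, R i →+* Node k}

/-! ### Regular elements in the conductor -/

/-- The node is not a domain, so that the conductor contains a nonzerodivisor. -/
lemma exists_mem_kerIdeal_ne_zero [∀ i, IsDomain (R i)] (hπ : ∀ i, Function.Surjective (π i)) :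
    ∃ s ∈ kerIdeal π, ∀ i, s i ≠ 0 := by
  have h : ∀ i, ∃ x : R i, π i x = 0 ∧ x ≠ 0 := fun i => by
    obtain ⟨x, hx⟩ := hπ i (nodeU k)
    obtain ⟨y, hy⟩ := hπ i (nodeV k)
    refine ⟨x * y, ?_, mul_ne_zero ?_ ?_⟩
    · rw [map_mul, hx, hy]
      exact Ideal.Quotient.eq_zero_iff_mem.mpr (Ideal.subset_span rfl)
    · rintro rfl
      apply PowerSeries.X_ne_zero (R := k)
      rw [← branch_zero_nodeU, ← hx, map_zero, map_zero]
    · rintro rfl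
      apply PowerSeries.X_ne_zero (R := k)
      rw [← branch_one_nodeV, ← hy, map_zero, map_zero]
  choose s hs hs0 using h
  exact ⟨s, (Ideal.mem_pi _ _).mpr hs, hs0⟩

variable [NeZero t]

lemma mem_nonZeroDivisors_gluedRing_of_forall_ne_zero [∀ i, IsDomain (R i)] {b : gluedRing π}
    (hb : ∀ i, (b : ∀ i, R i) i ≠ 0) : b ∈ nonZeroDivisors (gluedRing π) :=
  mem_nonZeroDivisors_iff_right.mpr fun _ hx => Subtype.ext <| funext fun i =>
    (mul_eq_zero.mp (congrFun (congrArg Subtype.val hx) i)).resolve_right (hb i)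

lemma ne_zero_of_mem_nonZeroDivisors_gluedRing [∀ i, IsDomain (R i)]
    (hπ : ∀ i, Function.Surjective (π i)) {b : gluedRing π}
    (hb : b ∈ nonZeroDivisors (gluedRing π)) (i : Fin t) : (b : ∀ i, R i) i ≠ 0 := by
  classical
  intro h
  obtain ⟨s, hs, hs0⟩ := exists_mem_kerIdeal_ne_zero hπ
  have hc : s * Pi.single i 1 ∈ kerIdeal π := Ideal.mul_mem_right _ _ hs
  have h0 : (⟨_, kerIdeal_le_gluedRing hc⟩ : gluedRing π) = 0 := by
    refine (mul_left_mem_nonZeroDivisors_eq_zero_iff hb).mp (Subtype.ext (funext fun j => ?_))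
    change (b : ∀ i, R i) j * (s j * (Pi.single i 1 : ∀ i, R i) j) = 0
    rcases eq_or_ne j i with rfl | hj
    · rw [h, zero_mul]
    · rw [Pi.single_eq_of_ne hj, mul_zero, mul_zero]
  have h1 : s i * (Pi.single i 1 : ∀ i, R i) i = 0 := congrFun (congrArg Subtype.val h0) i
  rw [Pi.single_eq_same, mul_one] at h1
  exact hs0 i h1

/-! ### The dualizing property of the conductor -/

variable (π) in
/-- The multiplication map `c ↦ (r ↦ c * r)` of the conductor to the linear maps of the product to
the glued ring. -/
def conductorMul : (kerIdeal π).restrictScalars (gluedRing π) →ₗ[gluedRing π]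
    ((∀ i, R i) →ₗ[gluedRing π] gluedRing π) where
  toFun c :=
    { toFun := fun r => ⟨c * r, kerIdeal_le_gluedRing (Ideal.mul_mem_right r _ c.2)⟩
      map_add' := fun _ _ => Subtype.ext (mul_add _ _ _)
      map_smul' := fun _ _ => Subtype.ext (mul_left_comm _ _ _) }
  map_add' _ _ := LinearMap.ext fun _ => Subtype.ext (add_mul _ _ _)
  map_smul' _ _ := LinearMap.ext fun _ => Subtype.ext (mul_assoc _ _ _)

lemma conductorMul_apply (c : (kerIdeal π).restrictScalars (gluedRing π)) (r : ∀ i, R i) :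
    (conductorMul π c r : ∀ i, R i) = c * r := rfl

lemma conductorMul_bijective [∀ i, IsDomain (R i)] (hπ : ∀ i, Function.Surjective (π i)) :
    Function.Bijective (conductorMul π) := by
  constructor
  · intro c c' h
    have h1 := congrArg Subtype.val (LinearMap.congr_fun h 1)
    rw [conductorMul_apply, conductorMul_apply, mul_one, mul_one] at h1
    exact Subtype.ext h1
  · intro f
    obtain ⟨s, hs, hs0⟩ := exists_mem_kerIdeal_ne_zero hπ
    -- a linear map is multiplication by its value at `1`, as seen after multiplication by `s`
    have hf : ∀ r, (f r : ∀ i, R i) = f 1 * r := fun r => by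
      have h1 := f.map_smul ⟨s, kerIdeal_le_gluedRing hs⟩ r
      have h2 := f.map_smul ⟨s * r, kerIdeal_le_gluedRing (Ideal.mul_mem_right r _ hs)⟩ 1
      have h3 : (⟨s, kerIdeal_le_gluedRing hs⟩ : gluedRing π) • r =
        (⟨s * r, kerIdeal_le_gluedRing (Ideal.mul_mem_right r _ hs)⟩ : gluedRing π) •
          (1 : ∀ i, R i) := (mul_one (s * r)).symm
      rw [h3, h2] at h1
      funext i
      have h4 : s i * r i * (f 1 : ∀ i, R i) i = s i * (f r : ∀ i, R i) i :=
        congrFun (congrArg Subtype.val h1) i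
      refine mul_left_cancel₀ (hs0 i) ?_
      rw [← h4, Pi.mul_apply]
      ring
    refine ⟨⟨f 1, (mem_kerIdeal_iff_forall_mul_mem hπ).mpr fun r => hf r ▸ (f r).2⟩, ?_⟩
    exact LinearMap.ext fun r => Subtype.ext (hf r).symm

/-! ### The normalization -/

/-- The map `r ↦ (s r) / s`, for a nonzerodivisor `s` in the conductor, identifies the product with
the integral closure of the glued ring in its total ring of fractions. -/
lemma exists_algHom_range_eq_integralClosure [∀ i, IsDomain (R i)]
    [∀ i, IsIntegrallyClosed (R i)] [Algebra.IsIntegral (gluedRing π) (∀ i, R i)]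
    (hπ : ∀ i, Function.Surjective (π i)) :
    ∃ j : (∀ i, R i) →ₐ[gluedRing π] FractionRing (gluedRing π),
      Function.Injective j ∧
        j.range = integralClosure (gluedRing π) (FractionRing (gluedRing π)) := by
  obtain ⟨s, hs, hs0⟩ := exists_mem_kerIdeal_ne_zero hπ
  have hsr : ∀ r, s * r ∈ gluedRing π := fun r =>
    kerIdeal_le_gluedRing (Ideal.mul_mem_right r _ hs)
  set A := gluedRing π
  let Q := FractionRing A
  let σ : A := ⟨s, kerIdeal_le_gluedRing hs⟩
  have hσ : σ ∈ nonZeroDivisors A := mem_nonZeroDivisors_gluedRing_of_forall_ne_zero hs0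
  obtain ⟨w, hw⟩ := (IsLocalization.map_units Q (⟨σ, hσ⟩ : nonZeroDivisors A)).exists_right_inv
  change algebraMap A Q σ * w = 1 at hw
  let num : (∀ i, R i) → A := fun r => ⟨s * r, hsr r⟩
  have hnum : ∀ r r', num r * num r' = σ * num (r * r') := fun r r' =>
    Subtype.ext (mul_mul_mul_comm s r s r' |>.trans (mul_assoc s s _))
  have hnumA : ∀ a : A, num a = σ * a := fun a => rfl
  let j : (∀ i, R i) →ₐ[A] Q :=
    { toFun := fun r => algebraMap A Q (num r) * w
      map_one' := by
        rw [← hw]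
        congr 2
        exact Subtype.ext (mul_one s)
      map_mul' := fun r r' => by
        have h := congrArg (algebraMap A Q) (hnum r r')
        rw [map_mul, map_mul] at h
        rw [mul_mul_mul_comm, h, mul_mul_mul_comm, hw, one_mul]
      map_zero' := by
        have h : num 0 = 0 := Subtype.ext (mul_zero s)
        rw [h, map_zero, zero_mul]
      map_add' := fun r r' => by
        have h : num (r + r') = num r + num r' := Subtype.ext (mul_add s r r')
        rw [h, map_add, add_mul]
      commutes' := fun a => by
        change algebraMap A Q (num a) * w = _
        rw [hnumA, map_mul, mul_right_comm, hw, one_mul] }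
  have hj : ∀ r, j r = algebraMap A Q (num r) * w := fun r => rfl
  refine ⟨j, ?_, ?_⟩
  · rw [injective_iff_map_eq_zero]
    intro r hr
    have hr' : algebraMap A Q (num r) = 0 := by
      rw [← mul_one (algebraMap A Q (num r)), ← hw, mul_left_comm, ← hj, hr, mul_zero]
    have hr0 := (IsFractionRing.injective A Q) (hr'.trans (map_zero _).symm)
    exact funext fun i =>
      (mul_eq_zero.mp (congrFun (congrArg Subtype.val hr0) i)).resolve_left (hs0 i)
  · ext y
    constructor
    · rintro ⟨r, rfl⟩
      exact (Algebra.IsIntegral.isIntegral (R := A) r).map j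
    · rintro ⟨p, hp, hpy⟩
      obtain ⟨a, b, rfl⟩ := IsLocalization.exists_mk'_eq (nonZeroDivisors A) y
      -- the `i`-th component of a fraction, in the fraction field of `R i`
      let ev : ∀ i, A →+* R i := fun i => (Pi.evalRingHom R i).comp A.subtype
      have hb : ∀ i, ev i b ≠ 0 := ne_zero_of_mem_nonZeroDivisors_gluedRing hπ b.2
      let θ : ∀ i, Q →+* FractionRing (R i) := fun i =>
        IsLocalization.lift (M := nonZeroDivisors A)
          (g := (algebraMap (R i) (FractionRing (R i))).comp (ev i)) fun c => by
            rw [isUnit_iff_ne_zero]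
            exact (map_ne_zero_iff _ (IsFractionRing.injective (R i) _)).mpr
              (ne_zero_of_mem_nonZeroDivisors_gluedRing hπ c.2 i)
      have hθ : ∀ i c, θ i (algebraMap A Q c) = algebraMap (R i) (FractionRing (R i)) (ev i c) :=
        fun i c => IsLocalization.lift_eq _ c
      have hint : ∀ i, IsIntegral (R i) (θ i (IsLocalization.mk' Q a b)) := fun i => by
        refine ⟨p.map (ev i), hp.map _, ?_⟩
        have hcomp : (algebraMap (R i) (FractionRing (R i))).comp (ev i) =
          (θ i).comp (algebraMap A Q) := RingHom.ext fun c => (hθ i c).symm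
        rw [Polynomial.eval₂_map, hcomp, ← Polynomial.hom_eval₂, hpy, map_zero]
      choose r hr using fun i => IsIntegrallyClosed.isIntegral_iff.mp (hint i)
      have hrb : r * b = (a : ∀ i, R i) := funext fun i => by
        apply IsFractionRing.injective (R i) (FractionRing (R i))
        change algebraMap _ _ (r i * ev i b) = algebraMap _ _ (ev i a)
        rw [map_mul, hr, ← hθ, ← map_mul, IsLocalization.mk'_spec, hθ]
      refine ⟨r, ?_⟩
      change j r = _
      rw [IsLocalization.eq_mk'_iff_mul_eq, ← j.commutes, ← map_mul]
      exact (congrArg j hrb).trans (j.commutes a)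

/-! ### Dimension and the Cohen–Macaulay property -/

lemma ringKrullDim_gluedRing [Algebra.IsIntegral (gluedRing π) (∀ i, R i)] (d : WithBot ℕ∞)
    (hd : ∀ i, ringKrullDim (R i) = d) : ringKrullDim (gluedRing π) = d := by
  classical
  have hint (r : ∀ i, R i) : (algebraMap (gluedRing π) (∀ i, R i)).IsIntegralElem r :=
    Algebra.IsIntegral.isIntegral r
  let (i : Fin t) : Algebra (gluedRing π) (R i) :=
    ((Pi.evalRingHom R i).comp (gluedRing π).subtype).toAlgebra
  have (i : Fin t) : Algebra.IsIntegral (gluedRing π) (R i) := ⟨fun x => by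
    obtain ⟨p, hp, hpx⟩ := hint (Pi.single i x)
    refine ⟨p, hp, ?_⟩
    have h := congrArg (Pi.evalRingHom R i) hpx
    rw [Polynomial.hom_eval₂, map_zero, Pi.evalRingHom_apply, Pi.single_eq_same] at h
    exact h⟩
  exact ringKrullDim_eq_of_isIntegral R (fun a ha => Subtype.ext (funext ha)) d hd

/-- The elementwise form of depth two for the glued ring. If `z` is divisible by `s` after
multiplication by any element of the maximal ideal, then each component of `z / s` lies in `R i`
because `R i` is normal of dimension two, and the resulting tuple satisfies the gluing conditions
because it does so after multiplication by an element restricting to the coordinate on every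
branch. -/
lemma dvd_of_forall_dvd_maximalIdeal_mul [∀ i, IsDomain (R i)] [∀ i, IsIntegrallyClosed (R i)]
    [∀ i, IsNoetherianRing (R i)] [∀ i, IsLocalRing (R i)] [IsLocalRing (gluedRing π)]
    (hd : ∀ i, 1 < ringKrullDim (R i)) (hπ : ∀ i, Function.Surjective (π i)) {s : gluedRing π}
    (hs : ∀ i, (s : ∀ i, R i) i ≠ 0) {z : gluedRing π}
    (hz : ∀ a ∈ IsLocalRing.maximalIdeal (gluedRing π), s ∣ a * z) : s ∣ z := by
  obtain ⟨τ, hτm, hτ⟩ := exists_mem_maximalIdeal_forall_branchAt_eq_X hπ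
  have hz' : ∀ a ∈ IsLocalRing.maximalIdeal (gluedRing π), ∀ i,
      (s : ∀ i, R i) i ∣ (a : ∀ i, R i) i * (z : ∀ i, R i) i := fun a ha i =>
    map_dvd ((Pi.evalRingHom R i).comp (gluedRing π).subtype) (hz a ha)
  have hsq : ∀ i, ∀ x ∈ IsLocalRing.maximalIdeal (R i), ∀ y ∈ IsLocalRing.maximalIdeal (R i),
      (s : ∀ i, R i) i ∣ x * y * (z : ∀ i, R i) i := by
    intro i x hx y hy
    obtain ⟨a, ha, e, he, c, hxy⟩ := exists_mul_eq_add_mul hπ hx hy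
    rw [hxy, add_mul, mul_comm _ c, mul_assoc]
    exact dvd_add (hz' _ he i) ((hz' _ ha i).mul_left _)
  have hdvd : ∀ i, (s : ∀ i, R i) i ∣ (z : ∀ i, R i) i := fun i => by
    let K := FractionRing (R i)
    have hs0 : algebraMap (R i) K ((s : ∀ i, R i) i) ≠ 0 :=
      (map_ne_zero_iff _ (IsFractionRing.injective (R i) K)).mpr (hs i)
    -- divisibility by `s i` means integrality of the fraction
    have hiff : ∀ x : R i, algebraMap (R i) K x * (algebraMap (R i) K ((z : ∀ i, R i) i) /
        algebraMap (R i) K ((s : ∀ i, R i) i)) ∈ (algebraMap (R i) K).range ↔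
        (s : ∀ i, R i) i ∣ x * (z : ∀ i, R i) i := fun x => by
      rw [← mul_div_assoc, ← map_mul]
      constructor
      · rintro ⟨y, hy⟩
        rw [eq_div_iff hs0, ← map_mul] at hy
        exact ⟨y, (mul_comm y _ ▸ IsFractionRing.injective (R i) K hy).symm⟩
      · rintro ⟨y, hy⟩
        exact ⟨y, by rw [hy, map_mul, mul_div_cancel_left₀ _ hs0]⟩
    rw [← one_mul ((z : ∀ i, R i) i), ← hiff, map_one, one_mul]
    refine mem_range_of_forall_maximalIdeal_mul_mem (hd i) fun x hx =>
      mem_range_of_forall_maximalIdeal_mul_mem (hd i) fun y hy => ?_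
    rw [← mul_assoc, ← map_mul, hiff]
    exact hsq i y hy x hx
  choose r hr using hdvd
  have hzr : (z : ∀ i, R i) = s * r := funext hr
  obtain ⟨b, hb⟩ := hz _ hτm
  have hτr : (τ : ∀ i, R i) * r = b := funext fun i => by
    have h1 : (τ : ∀ i, R i) i * (z : ∀ i, R i) i = (s : ∀ i, R i) i * (b : ∀ i, R i) i :=
      congrFun (congrArg Subtype.val hb) i
    rw [hr i, mul_left_comm] at h1
    exact mul_left_cancel₀ (hs i) h1
  refine ⟨⟨r, mem_gluedRing_iff.mpr fun i => ?_⟩, Subtype.ext hzr⟩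
  have h2 := mem_gluedRing_iff.mp (hτr ▸ b.2 : (τ : ∀ i, R i) * r ∈ gluedRing π) i
  rw [map_mul, map_mul, hτ, hτ] at h2
  exact mul_left_cancel₀ PowerSeries.X_ne_zero h2

lemma isCohenMacaulayRing_gluedRing [∀ i, IsDomain (R i)] [∀ i, IsIntegrallyClosed (R i)]
    [∀ i, IsNoetherianRing (R i)] [∀ i, IsLocalRing (R i)] [IsLocalRing (gluedRing π)]
    [IsNoetherianRing (gluedRing π)] (hd : ∀ i, ringKrullDim (R i) = 2)
    (hπ : ∀ i, Function.Surjective (π i)) (hA : ringKrullDim (gluedRing π) = 2) :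
    IsCohenMacaulayRing (gluedRing π) := by
  refine ⟨inferInstance, fun i hi => ?_⟩
  obtain ⟨s, hs, hs0⟩ := exists_mem_kerIdeal_ne_zero hπ
  refine subsingleton_ext_residueField (mem_maximalIdeal_of_mem_kerIdeal hπ hs)
    (mem_nonZeroDivisors_gluedRing_of_forall_ne_zero hs0)
    (fun z hz => dvd_of_forall_dvd_maximalIdeal_mul (fun i => ?_) hπ hs0 hz) ?_
  · rw [hd]
    decide
  · rw [hA] at hi
    have hi' : (i : ℕ∞) < 2 := WithBot.coe_lt_coe.mp hi
    exact ENat.natCast_lt_natCast.mp hi'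

/-! ### The quotients by the conductor -/

variable (π) in
/-- The restrictions of an element of the glued ring to the glued branches. -/
def gluedBranches : gluedRing π →+* (Fin t → PowerSeries k) :=
  RingHom.pi fun i => (branchAt π i 1).comp (gluedRing π).subtype

lemma ker_gluedBranches :
    RingHom.ker (gluedBranches π) = (kerIdeal π).comap (gluedRing π).subtype :=
  Ideal.ext fun a => funext_iff.trans (mem_kerIdeal_iff_of_mem_gluedRing a.2).symm

lemma range_gluedBranches (hπ : ∀ i, Function.Surjective (π i)) :
    (gluedBranches π).range = (axesRestrict k t).range := by
  ext h
  rw [mem_range_axesRestrict_iff]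
  constructor
  · rintro ⟨a, rfl⟩ i j
    exact constantCoeff_branchAt_eq a.2 i j 1 1
  · intro hh
    obtain ⟨a, ha, hab⟩ := exists_mem_gluedRing hπ h hh
    exact ⟨⟨a, ha⟩, funext fun i => (hab i).1⟩

lemma exists_ringEquiv_axesRing (hπ : ∀ i, Function.Surjective (π i)) :
    ∃ ψ : gluedRing π ⧸ (kerIdeal π).comap (gluedRing π).subtype ≃+* AxesRing k t,
      ∀ a : gluedRing π, axesRestrict k t (ψ (Ideal.Quotient.mk _ a)) = gluedBranches π a := by
  let e : AxesRing k t ≃+* (axesRestrict k t).range :=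
    RingEquiv.ofBijective (axesRestrict k t).rangeRestrict
      ⟨fun x y h => axesRestrict_injective (congrArg Subtype.val h),
        (axesRestrict k t).rangeRestrict_surjective⟩
  refine ⟨(Ideal.quotEquivOfEq ker_gluedBranches.symm).trans
    ((gluedBranches π).quotientKerEquivRange.trans
      ((RingEquiv.subringCongr (range_gluedBranches hπ)).trans e.symm)), fun a => ?_⟩
  exact congrArg Subtype.val (e.apply_symm_apply
    (RingEquiv.subringCongr (range_gluedBranches hπ) ((gluedBranches π).rangeRestrict a)))

lemma exists_quotient_ringEquiv (hπ : ∀ i, Function.Surjective (π i)) :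
    ∃ (ψ : gluedRing π ⧸ (kerIdeal π).comap (gluedRing π).subtype ≃+* AxesRing k t)
      (ρ : (∀ i, R i) ⧸ kerIdeal π ≃+* (∀ _ : Fin t, Node k)),
      (∀ (r : ∀ i, R i) (i : Fin t), ρ (Ideal.Quotient.mk (kerIdeal π) r) i = π i (r i)) ∧
      (∀ c : k, ρ (Ideal.quotientMap (kerIdeal π) (gluedRing π).subtype le_rfl
        (ψ.symm (axesC k t c))) = fun _ => nodeC k c) ∧
      (∀ i : Fin t, ρ (Ideal.quotientMap (kerIdeal π) (gluedRing π).subtype le_rfl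
        (ψ.symm (axesW k i))) = (Pi.single i (nodeV k) : Fin t → Node k) +
          (Pi.single (i + 1) (nodeU k) : Fin t → Node k)) := by
  obtain ⟨ψ, hψ⟩ := exists_ringEquiv_axesRing hπ
  let P : (∀ i, R i) →+* (Fin t → Node k) :=
    RingHom.pi fun i => (π i).comp (Pi.evalRingHom R i)
  have hP : Function.Surjective P := fun x => by
    choose r hr using fun i => hπ i (x i)
    exact ⟨r, funext hr⟩
  have hker : kerIdeal π = RingHom.ker P :=
    Ideal.ext fun r => (Ideal.mem_pi _ _).trans funext_iff.symm
  let ρ := (Ideal.quotEquivOfEq hker).trans (RingHom.quotientKerEquivOfSurjective hP)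
  have hρ : ∀ (r : ∀ i, R i) (i : Fin t), ρ (Ideal.Quotient.mk (kerIdeal π) r) i = π i (r i) :=
    fun r i => rfl
  -- the image of `x` in the product of nodes can be computed from any lift of `x`
  have key : ∀ (x : AxesRing k t) (a : gluedRing π), gluedBranches π a = axesRestrict k t x →
      ∀ i, ρ (Ideal.quotientMap (kerIdeal π) (gluedRing π).subtype le_rfl (ψ.symm x)) i =
        π i ((a : ∀ i, R i) i) := fun x a h i => by
    have hx : ψ.symm x = Ideal.Quotient.mk _ a := by
      rw [RingEquiv.symm_apply_eq]
      exact axesRestrict_injective (h.symm.trans (hψ a).symm)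
    rw [hx, Ideal.quotientMap_mk, hρ]
    rfl
  refine ⟨ψ, ρ, hρ, fun c => funext fun i => ?_, fun i => funext fun j => ?_⟩
  · obtain ⟨a, ha, hab⟩ := exists_mem_gluedRing_forall_branchAt_eq hπ (PowerSeries.C c)
    rw [key _ ⟨a, ha⟩ (funext fun i => by rw [axesRestrict_axesC]; exact hab i 1)]
    exact node_ext fun b => (hab i b).trans (branch_nodeC b c).symm
  · obtain ⟨a, ha, hab⟩ := exists_mem_gluedRing hπ (Pi.single i (PowerSeries.X (R := k)))
      (by
        have h0 : ∀ j, PowerSeries.constantCoeff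
            ((Pi.single i PowerSeries.X : Fin t → PowerSeries k) j) = 0 := fun j => by
          rcases eq_or_ne j i with rfl | h
          · rw [Pi.single_eq_same, PowerSeries.constantCoeff_X]
          · rw [Pi.single_eq_of_ne h, map_zero]
        exact fun j j' => (h0 j).trans (h0 j').symm)
    rw [key _ ⟨a, ha⟩ (funext fun j => by rw [axesRestrict_axesW]; exact (hab j).1)]
    have happly : ∀ (b : Fin 2) (l : Fin t) (x : Node k),
        branch k b ((Pi.single l x : Fin t → Node k) j) =
          (Pi.single l (branch k b x) : Fin t → PowerSeries k) j := fun b l x =>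
      (Pi.apply_single (fun _ => branch k b) (fun _ => map_zero _) l x j)
    refine node_ext (Fin.forall_fin_two.mpr ⟨?_, ?_⟩)
    · rw [Pi.add_apply, map_add, happly, happly, branch_zero_nodeV, branch_zero_nodeU,
        Pi.single_zero, Pi.zero_apply, zero_add]
      obtain ⟨l, rfl⟩ : ∃ l, j = l + 1 := ⟨j - 1, (sub_add_cancel j 1).symm⟩
      refine (hab l).2.trans ?_
      rcases eq_or_ne l i with rfl | h
      · rw [Pi.single_eq_same, Pi.single_eq_same]
      · rw [Pi.single_eq_of_ne h, Pi.single_eq_of_ne (by simpa using h)]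
    · rw [Pi.add_apply, map_add, happly, happly, branch_one_nodeV, branch_one_nodeU,
        Pi.single_zero, Pi.zero_apply, add_zero]
      exact (hab j).1

end ConductorAndDepth

end CyclicGluing

end

theorem propositionP {k : Type*} [Field k] [IsAlgClosed k] (t : ℕ) [NeZero t]
    (R : Fin t → Type*) [∀ i, CommRing (R i)] [∀ i, Algebra k (R i)]
    [∀ i, IsDomain (R i)] [∀ i, IsIntegrallyClosed (R i)]
    [∀ i, IsNoetherianRing (R i)] [∀ i, IsLocalRing (R i)]
    [∀ i, IsAdicComplete (IsLocalRing.maximalIdeal (R i)) (R i)]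
    (hdim : ∀ i, ringKrullDim (R i) = 2)
    (π : ∀ i, R i →+* CyclicGluing.Node k) (hπ : ∀ i, Function.Surjective (π i)) :
    let A : Subring (∀ i, R i) := CyclicGluing.gluedRing π
    ∃ (_ : IsLocalRing A) (_ : IsNoetherianRing A),
      -- `A` is reduced, and `A ⊆ R` is finite
      IsReduced A ∧ Module.Finite A (∀ i, R i) ∧
      -- `I = ker π` is the conductor of `A ⊆ R`, and multiplication identifies `I` with `Hom_A(R, A)`
      ((CyclicGluing.kerIdeal π : Ideal (∀ i, R i)) : Set (∀ i, R i)) = {c | ∀ r : ∀ i, R i, c * r ∈ A} ∧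
      (∃ e : (CyclicGluing.kerIdeal π).restrictScalars A ≃ₗ[A] ((∀ i, R i) →ₗ[A] A),
        ∀ (c : (CyclicGluing.kerIdeal π).restrictScalars A) (r : ∀ i, R i), (e c r : ∀ i, R i) = c * r) ∧
      -- `A` is complete of dimension two
      IsAdicComplete (IsLocalRing.maximalIdeal A) A ∧ ringKrullDim A = 2 ∧
      -- `R` is the integral closure of `A` in the total ring of fractions of `A`
      (∃ j : (∀ i, R i) →ₐ[A] FractionRing A,
        Function.Injective j ∧ j.range = integralClosure A (FractionRing A)) ∧
      -- the rings `A / I` and `R / I`, and the canonical map between them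
      (∃ (ψ : A ⧸ (CyclicGluing.kerIdeal π).comap A.subtype ≃+* CyclicGluing.AxesRing k t)
          (ρ : (∀ i, R i) ⧸ CyclicGluing.kerIdeal π ≃+* (∀ _ : Fin t, CyclicGluing.Node k)),
        (∀ (r : ∀ i, R i) (i : Fin t), ρ (Ideal.Quotient.mk (CyclicGluing.kerIdeal π) r) i = π i (r i)) ∧
        (∀ c : k, ρ (Ideal.quotientMap (CyclicGluing.kerIdeal π) A.subtype le_rfl (ψ.symm (CyclicGluing.axesC k t c)))
          = fun _ => CyclicGluing.nodeC k c) ∧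
        (∀ i : Fin t,
          ρ (Ideal.quotientMap (CyclicGluing.kerIdeal π) A.subtype le_rfl (ψ.symm (CyclicGluing.axesW k i)))
            = (Pi.single i (CyclicGluing.nodeV k) : Fin t → CyclicGluing.Node k) +
              (Pi.single (i + 1) (CyclicGluing.nodeU k) : Fin t → CyclicGluing.Node k))) ∧
      -- `A` is Cohen–Macaulay
      CyclicGluing.IsCohenMacaulayRing A := by
  intro A
  have hlocal := CyclicGluing.isLocalRing_gluedRing hπ
  have hnoeth := CyclicGluing.isNoetherianRing_gluedRing hπ
  have := CyclicGluing.isNoetherian_gluedRing_pi hπ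
  have hfin : Module.Finite A (∀ i, R i) := inferInstance
  have hint : Algebra.IsIntegral A (∀ i, R i) := inferInstance
  have hA : ringKrullDim A = 2 := CyclicGluing.ringKrullDim_gluedRing 2 hdim
  refine ⟨hlocal, hnoeth, ?_, hfin, ?_, ?_, CyclicGluing.isAdicComplete_gluedRing hπ, hA,
    CyclicGluing.exists_algHom_range_eq_integralClosure hπ,
    CyclicGluing.exists_quotient_ringEquiv hπ,
    CyclicGluing.isCohenMacaulayRing_gluedRing hdim hπ hA⟩
  · exact isReduced_of_injective A.subtype Subtype.val_injective
  · exact Set.ext fun c => CyclicGluing.mem_kerIdeal_iff_forall_mul_mem hπ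
  · exact ⟨LinearEquiv.ofBijective (CyclicGluing.conductorMul π)
      (CyclicGluing.conductorMul_bijective hπ), CyclicGluing.conductorMul_apply⟩
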